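/- Let $N$ tasks be given. Task $i$ is a Markov decision process with finite state set $\mathcal S_i$, finite nonempty action set $\mathcal A_i$, transition probabilities $\mathcal P_i(s'\mid s,a)$ and real reward function $\mathcal R_i(s,a)$. Let $\gamma\in[0,1)$ be the discount factor, $\lambda\ge 0$ the personalization weight, $Q_i^{\pi}:\mathcal S_i\times\mathcal A_i\to\mathbb R$ a fixed (meta) Q-table for each task, and let the learning rates $\eta^k\ge 0$ satisfy $\sum_k\eta^k=\infty$ and $\sum_k(\eta^k)^2<\infty$. Starting from arbitrary tables $Q_{i,0}$ and $\widetilde Q_{i,0}$, consider the exact iteration $$Q_{i,k+1}(s,a)=Q_{i,k}(s,a)+\eta^k\Big[\mathcal R_i(s,a)+\gamma\,\mathbb E_{s'\sim\mathcal P_i(\cdot\mid s,a)}\max_{a'}Q_{i,k}(s',a')-Q_{i,k}(s,a)\Big]-\frac{\eta^k\lambda}{2}\cdot 2\big(Q_{i,k}(s,a)-Q_i^{\pi}(s,a)\big)$$ and the sampled iteration $$\widetilde Q_{i,k+1}(s,a)=\widetilde Q_{i,k}(s,a)+\eta^k\Big[\mathcal R_i(s,a)+\gamma\max_{a'}\widetilde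 Q_{i,k}(s'_{i,k}(s,a),a')-\widetilde Q_{i,k}(s,a)\Big]-\frac{\eta^k\lambda}{2}\cdot 2\big(\widetilde Q_{i,k}(s,a)-Q_i^{\pi}(s,a)\big),$$ where each $s'_{i,k}(s,a)$ is a random state, known at time $k+1$ of a filtration $(\mathcal F_k)$, whose conditional law given the past $\mathcal F_k$ is $\mathcal P_i(\cdot\mid s,a)$. Let $$\hat{\mathcal B}_iQ(s,a)=\frac{\lambda}{1+\lambda}Q_i^{\pi}(s,a)+\frac1{1+\lambda}\Big(\mathcal R_i(s,a)+\gamma\,\mathbb E_{s'\sim\mathcal P_i(\cdot\mid s,a)}\max_{a'}Q(s',a')\Big).$$ Then: 1. For every task $i$ and all tables $Q^1,Q^2$, $\|\hat{\mathcal B}_iQ^1-\hat{\mathcal B}_iQ^2\|_\infty\le\frac{\gamma}{1+\lambda}\|Q^1-Q^2\|_\infty$. 2. Each $\hat{\mathcal B}_i$ has exactly one fixed point $Q_i^*$, and almost surely $\widetilde Q_{i,k}\to Q_i^*$ as $k\to\infty$ for every $i$. 3. Almost surely, for every $\delta>0$ there is $K_0$ such that for all $K\ge K_0$ $$\big|Q_{i,K}(s,a)-\widetilde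 Q_{i,K}(s,a)\big|\le\delta\qquad\text{for all } i,\ s\in\mathcal S_i,\ a\in\mathcal A_i.$$ -/

import Mathlib

open MeasureTheory Filter Topology

/-- A finite Markov decision process without its discount factor: transition probabilities
`P s a s'` and a reward function `R`. (On finite state and action spaces the reward is
automatically bounded.) -/
structure FiniteMDP (S A : Type*) [Fintype S] where
  P : S → A → S → ℝ
  P_nonneg : ∀ s a s', 0 ≤ P s a s'
  P_sum_eq_one : ∀ s a, ∑ s', P s a s' = 1
  R : S → A → ℝ

/-- `max_{a'} Q(s, a')`. -/
noncomputable def maxAction {S A : Type*} [Fintype A] [Nonempty A]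
    (Q : S → A → ℝ) (s : S) : ℝ :=
  Finset.univ.sup' Finset.univ_nonempty (fun a => Q s a)

/-- The Bellman optimality operator
`Q ↦ R(s, a) + γ E_{s' ∼ P(· | s, a)} [max_{a'} Q(s', a')]`. -/
noncomputable def bellman {S A : Type*} [Fintype S] [Fintype A] [Nonempty A]
    (M : FiniteMDP S A) (γ : ℝ) (Q : S → A → ℝ) : S → A → ℝ :=
  fun s a => M.R s a + γ * ∑ s', M.P s a s' * maxAction Q s'

/-- The regularized Bellman operator
`Q ↦ λ/(1+λ) Qmeta + 1/(1+λ) (R + γ E [max Q])`. -/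
noncomputable def regBellman {S A : Type*} [Fintype S] [Fintype A] [Nonempty A]
    (M : FiniteMDP S A) (γ lam : ℝ) (Qmeta : S → A → ℝ) (Q : S → A → ℝ) : S → A → ℝ :=
  fun s a => lam / (1 + lam) * Qmeta s a + 1 / (1 + lam) * bellman M γ Q s a

/-- The gradient at `Q` of the personalization penalty `φ(Q, Qmeta) = (Q - Qmeta)²`, for every
state and action. -/
def penaltyGrad {S A : Type*} (Q Qmeta : S → A → ℝ) : S → A → ℝ :=
  fun s a => 2 * (Q s a - Qmeta s a)

/-- The exact personalized Q-iteration: gradient descent steps with step sizes `η k`, in which the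
expectation over the next state is computed exactly. -/
noncomputable def exactQ {S A : Type*} [Fintype S] [Fintype A] [Nonempty A]
    (M : FiniteMDP S A) (γ lam : ℝ) (η : ℕ → ℝ) (Qmeta Q₀ : S → A → ℝ) : ℕ → S → A → ℝ
  | 0 => Q₀
  | k + 1 => fun s a =>
      let Q := exactQ M γ lam η Qmeta Q₀ k
      Q s a
        + η k * (M.R s a + γ * ∑ s', M.P s a s' * maxAction Q s' - Q s a)
        - η k * lam / 2 * penaltyGrad Q Qmeta s a

/-- The sampled personalized Q-iteration: the expectation over the next state is replaced, in
step `k`, by the value at the sampled next state `x k s a`. -/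
noncomputable def sampledQ {S A : Type*} [Fintype S] [Fintype A] [Nonempty A]
    (M : FiniteMDP S A) (γ lam : ℝ) (η : ℕ → ℝ) (Qmeta Q₀ : S → A → ℝ)
    (x : ℕ → S → A → S) : ℕ → S → A → ℝ
  | 0 => Q₀
  | k + 1 => fun s a =>
      let Q := sampledQ M γ lam η Qmeta Q₀ x k
      Q s a
        + η k * (M.R s a + γ * maxAction Q (x k s a) - Q s a)
        - η k * lam / 2 * penaltyGrad Q Qmeta s a

/-- `X k ω s a` is the next state sampled in step `k` for the pair `(s, a)`: it is revealed between
the times `k` and `k + 1` of the filtration `ℱ`, and given the past `ℱ k` it has the transition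
law `M.P s a`. -/
structure IsTransitionSampling {Ω : Type*} {mΩ : MeasurableSpace Ω} (μ : Measure Ω)
    (ℱ : Filtration ℕ mΩ) {S A : Type*} [Fintype S] (M : FiniteMDP S A)
    (X : ℕ → Ω → S → A → S) : Prop where
  measurable : ∀ k s a s', MeasurableSet[ℱ (k + 1)] {ω | X k ω s a = s'}
  law : ∀ k s a s',
    μ[Set.indicator {ω | X k ω s a = s'} (fun _ => (1 : ℝ)) | ℱ k] =ᵐ[μ] fun _ => M.P s a s'

/-! With α_k = (1+λ)η_k the penalty merges with the step, and both iterations read Y_{k+1} = Y_k +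
α_k(B̂Y_k + w_k − Y_k), where w = 0 in the exact case and w is the sampling error otherwise
(`exactQ_succ`, `sampledQ_succ`). Since B̂ contracts the sup norm by γ/(1+λ) < 1, Banach's theorem
gives its fixed point.

The sampled tables are bounded by a constant independent of the samples (`exists_norm_sampledQ_le`),
so each entry of α_k w_k is a martingale difference with deterministic, square-summable bounds, and
the noise series converges almost surely (`ae_exists_tendsto_sum_of_martingale_difference`). The
rest is pathwise: `tendsto_of_contracting_of_noise` splits off the response to the noise alone, and
the contraction absorbs what remains. Both iterations thus share one limit, so their difference
tends to zero. -/

/-! ### Deterministic stochastic approximation -/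

/-- A real recursion that averages with weights of divergent sum against a null sequence tends
to zero. -/
theorem tendsto_zero_of_le_average {x α ε : ℕ → ℝ} (hx : ∀ k, 0 ≤ x k) (hα₀ : ∀ k, 0 ≤ α k)
    (hα₁ : ∀ᶠ k in atTop, α k ≤ 1) (hα : ¬ Summable α) (hε : Tendsto ε atTop (𝓝 0))
    (h : ∀ᶠ k in atTop, x (k + 1) ≤ (1 - α k) * x k + α k * ε k) :
    Tendsto x atTop (𝓝 0) := by
  have hsum : Tendsto (fun n => ∑ k ∈ Finset.range n, α k) atTop atTop :=
    (not_summable_iff_tendsto_nat_atTop_of_nonneg hα₀).1 hα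
  rw [Metric.tendsto_atTop]
  intro δ hδ
  obtain ⟨K, hK⟩ := eventually_atTop.1
    ((hα₁.and h).and (hε.eventually (gt_mem_nhds (half_pos hδ))))
  -- Past `K` the excess over δ/2 shrinks by 1 − α_k ≤ exp(−α_k). Starting from `x K` instead of `x
  -- K - δ / 2` keeps the bound nonnegative, as the last comparison requires.
  have key : ∀ k, K ≤ k → x k - δ / 2 ≤
      x K * Real.exp (∑ j ∈ Finset.range K, α j) * Real.exp (-∑ j ∈ Finset.range k, α j) := by
    intro k hk
    induction k, hk using Nat.le_induction with
    | base =>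
      rw [mul_assoc, ← Real.exp_add, add_neg_cancel, Real.exp_zero]
      linarith
    | succ k hk ih =>
      obtain ⟨⟨h1, h2⟩, h3⟩ := hK k hk
      rw [Finset.sum_range_succ, neg_add, Real.exp_add, ← mul_assoc]
      set D := x K * Real.exp (∑ j ∈ Finset.range K, α j) * Real.exp (-∑ j ∈ Finset.range k, α j)
      have hD : 0 ≤ D := by have := hx K; positivity
      have he : 1 - α k ≤ Real.exp (-α k) := by
        linarith [Real.add_one_le_exp (-α k)]
      calc x (k + 1) - δ / 2 ≤ (1 - α k) * (x k - δ / 2) := by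
            nlinarith [mul_le_mul_of_nonneg_left h3.le (hα₀ k)]
        _ ≤ (1 - α k) * D := mul_le_mul_of_nonneg_left ih (by linarith)
        _ ≤ D * Real.exp (-α k) := by rw [mul_comm]; exact mul_le_mul_of_nonneg_left he hD
  have hlim : Tendsto (fun k => x K * Real.exp (∑ j ∈ Finset.range K, α j) *
      Real.exp (-∑ j ∈ Finset.range k, α j)) atTop (𝓝 0) := by
    simpa using (Real.tendsto_exp_neg_atTop_nhds_zero.comp hsum).const_mul
      (x K * Real.exp (∑ j ∈ Finset.range K, α j))
  obtain ⟨K', hK'⟩ := eventually_atTop.1 (hlim.eventually (gt_mem_nhds (half_pos hδ)))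
  refine ⟨max K K', fun k hk => ?_⟩
  have h1 := key k (le_of_max_le_left hk)
  have h2 := hK' k (le_of_max_le_right hk)
  rw [Real.dist_eq, sub_zero, abs_of_nonneg (hx k)]
  linarith

/-- Convergence of a stochastic approximation scheme, along one path, for an operator that
contracts towards `q`, when the weighted noise is summable in the order of the steps. -/
theorem tendsto_of_contracting_of_noise {E : Type*} [NormedAddCommGroup E] [NormedSpace ℝ E]
    {F : E → E} {q : E} {c : ℝ} (hc₀ : 0 ≤ c) (hc₁ : c < 1) (hF : ∀ x, ‖F x - q‖ ≤ c * ‖x - q‖)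
    {α : ℕ → ℝ} (hα₀ : ∀ k, 0 ≤ α k) (hα₁ : ∀ᶠ k in atTop, α k ≤ 1) (hα : ¬ Summable α)
    {Y w : ℕ → E} (hY : ∀ k, Y (k + 1) = Y k + α k • (F (Y k) + w k - Y k)) {L : E}
    (hw : Tendsto (fun n => ∑ k ∈ Finset.range n, α k • w k) atTop (𝓝 L)) :
    Tendsto Y atTop (𝓝 q) := by
  -- `T` is the tail of the noise series. Averaging it to `v` gives a `u = v - T` with u_{k+1} = (1
  -- − α_k)u_k + α_k w_k: the response to the noise alone, null without any bound on ‖w_k‖.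
  set T : ℕ → E := fun n => L - ∑ k ∈ Finset.range n, α k • w k with hT
  have hT₀ : Tendsto T atTop (𝓝 0) := by simpa using hw.const_sub L
  have hTs : ∀ k, T (k + 1) = T k - α k • w k := fun k => by
    simp only [hT, Finset.sum_range_succ]; abel
  let v : ℕ → E := fun n => Nat.rec 0 (fun k x => (1 - α k) • x + α k • T k) n
  have hvs : ∀ k, v (k + 1) = (1 - α k) • v k + α k • T k := fun k => rfl
  have hv₀ : Tendsto v atTop (𝓝 0) := by
    rw [tendsto_zero_iff_norm_tendsto_zero]
    refine tendsto_zero_of_le_average (fun _ => norm_nonneg _) hα₀ hα₁ hα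
      (tendsto_zero_iff_norm_tendsto_zero.1 hT₀) ?_
    filter_upwards [hα₁] with k hk
    rw [hvs]
    refine (norm_add_le _ _).trans ?_
    rw [norm_smul, norm_smul, Real.norm_of_nonneg (hα₀ k), Real.norm_of_nonneg (by linarith)]
  set u : ℕ → E := fun k => v k - T k with hu
  have hu₀ : Tendsto u atTop (𝓝 0) := by simpa using hv₀.sub hT₀
  set Z : ℕ → E := fun k => Y k - q - u k with hZ
  have hc : 0 < 1 - c := by linarith
  have hZ₀ : Tendsto Z atTop (𝓝 0) := by
    rw [tendsto_zero_iff_norm_tendsto_zero]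
    -- Contraction turns the weight α_k into (1 − c)α_k; the error cα_k‖u_k‖ is rescaled to match
    -- it.
    refine tendsto_zero_of_le_average (α := fun k => (1 - c) * α k)
      (ε := fun k => c / (1 - c) * ‖u k‖) (fun _ => norm_nonneg _)
      (fun k => mul_nonneg hc.le (hα₀ k)) ?_ ?_ ?_ ?_
    · filter_upwards [hα₁] with k hk
      nlinarith [hα₀ k]
    · rwa [summable_mul_left_iff hc.ne']
    · simpa using hu₀.norm.const_mul (c / (1 - c))
    · filter_upwards [hα₁] with k hk
      have h1 : Z (k + 1) = (1 - α k) • Z k + α k • (F (Y k) - q) := by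
        simp only [hZ, hu, hY, hvs, hTs]
        module
      have h2 : ‖Y k - q‖ ≤ ‖Z k‖ + ‖u k‖ := by
        have : Y k - q = Z k + u k := by simp [hZ]
        rw [this]; exact norm_add_le _ _
      have h3 : ‖F (Y k) - q‖ ≤ c * (‖Z k‖ + ‖u k‖) :=
        (hF _).trans (mul_le_mul_of_nonneg_left h2 hc₀)
      calc ‖Z (k + 1)‖ ≤ (1 - α k) * ‖Z k‖ + α k * ‖F (Y k) - q‖ := by
            rw [h1]
            refine (norm_add_le _ _).trans ?_
            rw [norm_smul, norm_smul, Real.norm_of_nonneg (hα₀ k),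
              Real.norm_of_nonneg (by linarith)]
        _ ≤ (1 - α k) * ‖Z k‖ + α k * (c * (‖Z k‖ + ‖u k‖)) := by
            gcongr; exact hα₀ k
        _ = (1 - (1 - c) * α k) * ‖Z k‖ + (1 - c) * α k * (c / (1 - c) * ‖u k‖) := by
            field_simp
            ring
  have : Y = fun k => Z k + u k + q := by
    funext k; simp [hZ]
  rw [this]
  simpa using (hZ₀.add hu₀).add_const q

/-! ### Almost sure convergence of the noise series -/

/-- A series of bounded martingale differences with square-summable bounds converges almost
surely. -/
theorem ae_exists_tendsto_sum_of_martingale_difference {Ω : Type*} {mΩ : MeasurableSpace Ω}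
    {μ : Measure Ω} [IsProbabilityMeasure μ] {ℱ : Filtration ℕ mΩ} {d : ℕ → Ω → ℝ} {b : ℕ → ℝ}
    (hd : ∀ k, StronglyMeasurable[ℱ (k + 1)] (d k)) (hb : ∀ k ω, |d k ω| ≤ b k)
    (hb₂ : Summable fun k => b k ^ 2) (hd₀ : ∀ k, μ[d k | ℱ k] =ᵐ[μ] 0) :
    ∀ᵐ ω ∂μ, ∃ l, Tendsto (fun n => ∑ k ∈ Finset.range n, d k ω) atTop (𝓝 l) := by
  set f : ℕ → Ω → ℝ := fun n ω => ∑ k ∈ Finset.range n, d k ω with hf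
  have hfs : ∀ n ω, f (n + 1) ω = f n ω + d n ω := fun n ω => Finset.sum_range_succ _ _
  have hfm : ∀ n, StronglyMeasurable[ℱ n] (f n) := fun n =>
    Finset.stronglyMeasurable_fun_sum _ fun k hk =>
      (hd k).mono (ℱ.mono (Finset.mem_range.1 hk))
  have hfm' : ∀ n, AEStronglyMeasurable (f n) μ := fun n =>
    ((hfm n).mono (ℱ.le n)).aestronglyMeasurable
  have hdm' : ∀ n, AEStronglyMeasurable (d n) μ := fun n =>
    ((hd n).mono (ℱ.le _)).aestronglyMeasurable
  have hfb : ∀ n ω, |f n ω| ≤ ∑ k ∈ Finset.range n, b k := fun n ω =>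
    (Finset.abs_sum_le_sum_abs _ _).trans (Finset.sum_le_sum fun k _ => hb k ω)
  have hfi : ∀ n, Integrable (f n) μ := fun n =>
    Integrable.of_bound (hfm' n) _ (ae_of_all _ (hfb n))
  have hdi : ∀ n, Integrable (d n) μ := fun n =>
    Integrable.of_bound (hdm' n) _ (ae_of_all _ (hb n))
  have hfdi : ∀ n, Integrable (fun ω => f n ω * d n ω) μ := fun n =>
    (hdi n).bdd_mul (hfm' n) (ae_of_all _ (hfb n))
  have hmart : Martingale f ℱ μ := by
    refine martingale_of_condExp_sub_eq_zero_nat hfm hfi fun n => ?_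
    have : f (n + 1) - f n = d n := by funext ω; simp [hfs]
    rw [this]; exact hd₀ n
  have horth : ∀ n, ∫ ω, f n ω * d n ω ∂μ = 0 := by
    intro n
    have h1 : μ[f n * d n | ℱ n] =ᵐ[μ] f n * μ[d n | ℱ n] :=
      condExp_mul_of_stronglyMeasurable_left (hfm n) (hfdi n) (hdi n)
    have h2 : μ[f n * d n | ℱ n] =ᵐ[μ] 0 := by
      filter_upwards [h1, hd₀ n] with ω h h'
      simp [h, h']
    have h3 := integral_condExp (μ := μ) (f := f n * d n) (ℱ.le n)
    rw [integral_congr_ae h2] at h3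
    simpa using h3.symm
  have hf2i : ∀ n, Integrable (fun ω => f n ω ^ 2) μ := fun n => by
    simp only [pow_two]
    exact (hfi n).bdd_mul (hfm' n) (ae_of_all _ (hfb n))
  have hd2i : ∀ n, Integrable (fun ω => d n ω ^ 2) μ := fun n => by
    simp only [pow_two]
    exact (hdi n).bdd_mul (hdm' n) (ae_of_all _ (hb n))
  -- Orthogonality removes the cross term, so second moments add up.
  have hsq : ∀ n, ∫ ω, f n ω ^ 2 ∂μ ≤ ∑ k ∈ Finset.range n, b k ^ 2 := by
    intro n
    induction n with
    | zero => simp [hf]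
    | succ n ih =>
      have h1 : ∀ ω, f (n + 1) ω ^ 2 = f n ω ^ 2 + 2 * (f n ω * d n ω) + d n ω ^ 2 := fun ω => by
        rw [hfs]; ring
      simp only [h1]
      have h3 : Integrable (fun ω => f n ω ^ 2 + 2 * (f n ω * d n ω)) μ :=
        (hf2i n).add ((hfdi n).const_mul 2)
      rw [integral_add h3 (hd2i n), integral_add (hf2i n) ((hfdi n).const_mul 2),
        integral_const_mul, horth, Finset.sum_range_succ]
      have h2 : ∫ ω, d n ω ^ 2 ∂μ ≤ b n ^ 2 := by
        have := integral_mono (hd2i n) (integrable_const (b n ^ 2))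
          (fun ω => sq_le_sq' (abs_le.1 (hb n ω)).1 (abs_le.1 (hb n ω)).2)
        simpa using this
      linarith
  have hbdd : ∀ n, eLpNorm (f n) 1 μ ≤ (Real.toNNReal (1 + ∑' k, b k ^ 2) : ENNReal) := by
    intro n
    rw [eLpNorm_one_eq_lintegral_enorm, ← ofReal_integral_norm_eq_lintegral_enorm (hfi n)]
    refine ENNReal.ofReal_le_ofReal ?_
    -- The L² bound yields the L¹ bound of the convergence theorem via |t| ≤ 1 + t².
    calc ∫ ω, ‖f n ω‖ ∂μ ≤ ∫ ω, (1 + f n ω ^ 2) ∂μ := by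
          refine integral_mono (hfi n).norm ((integrable_const _).add (hf2i n)) fun ω => ?_
          simp only [Real.norm_eq_abs]
          nlinarith [sq_abs (f n ω), sq_nonneg (|f n ω| - 1), abs_nonneg (f n ω)]
      _ = 1 + ∫ ω, f n ω ^ 2 ∂μ := by
          rw [integral_add (integrable_const _) (hf2i n)]; simp
      _ ≤ 1 + ∑' k, b k ^ 2 := by
          gcongr
          exact (hsq n).trans (hb₂.sum_le_tsum _ fun k _ => sq_nonneg _)
  filter_upwards [hmart.submartingale.ae_tendsto_limitProcess hbdd] with ω hω
  exact ⟨_, hω⟩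
-- Boundedness and auxiliary estimates
/-- A recursion that averages with an affine contraction is bounded, uniformly in the sequence. -/
theorem exists_bound_of_average_affine {α : ℕ → ℝ} (hα₀ : ∀ k, 0 ≤ α k)
    (hα₁ : ∀ᶠ k in atTop, α k ≤ 1) {c : ℝ} (hc₀ : 0 ≤ c) (hc₁ : c < 1) (C y₀ : ℝ) :
    ∃ B, ∀ y : ℕ → ℝ, y 0 ≤ y₀ →
      (∀ k, y (k + 1) ≤ |1 - α k| * y k + α k * (C + c * y k)) → ∀ k, y k ≤ B := by
  -- The extremal recursion dominates every admissible `y`, whence the uniformity; the absolute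
  -- value allows for early steps with α_k > 1.
  let b : ℕ → ℝ := fun n => Nat.rec y₀ (fun k x => |1 - α k| * x + α k * (C + c * x)) n
  have hbs : ∀ k, b (k + 1) = |1 - α k| * b k + α k * (C + c * b k) := fun k => rfl
  have hbdd : BddAbove (Set.range b) := by
    obtain ⟨K, hK⟩ := eventually_atTop.1 hα₁
    have hc : 0 < 1 - c := by linarith
    -- C/(1 − c) is the fixed point of t ↦ C + ct; levels above it are not exceeded by averaging.
    have hle : ∀ᶠ k in atTop, b k ≤ max (b K) (C / (1 - c)) := by
      filter_upwards [eventually_ge_atTop K] with k hk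
      induction k, hk using Nat.le_induction with
      | base => exact le_max_left _ _
      | succ k hk ih =>
        have h1 : C ≤ (1 - c) * max (b K) (C / (1 - c)) := by
          rw [← div_le_iff₀' hc]; exact le_max_right _ _
        set D := max (b K) (C / (1 - c))
        rw [hbs, abs_of_nonneg (by linarith [hK k hk])]
        have h2 : C + c * b k ≤ D := by nlinarith
        nlinarith [mul_le_mul_of_nonneg_left h2 (hα₀ k),
          mul_le_mul_of_nonneg_left ih (sub_nonneg.2 (hK k hk))]
    exact IsBoundedUnder.bddAbove_range ⟨_, hle⟩
  obtain ⟨B, hB⟩ := hbdd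
  refine ⟨B, fun y hy₀ hy k => le_trans ?_ (hB ⟨k, rfl⟩)⟩
  induction k with
  | zero => exact hy₀
  | succ k ih =>
    rw [hbs]
    refine (hy k).trans ?_
    gcongr
    exact hα₀ k

theorem FiniteMDP.abs_sum_mul_le {S A : Type*} [Fintype S] (M : FiniteMDP S A) (s : S) (a : A)
    {v : S → ℝ} {r : ℝ} (hv : ∀ s', |v s'| ≤ r) : |∑ s', M.P s a s' * v s'| ≤ r := by
  calc |∑ s', M.P s a s' * v s'| ≤ ∑ s', |M.P s a s' * v s'| := Finset.abs_sum_le_sum_abs _ _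
    _ ≤ ∑ s', M.P s a s' * r := Finset.sum_le_sum fun s' _ => by
        rw [abs_mul, abs_of_nonneg (M.P_nonneg s a s')]
        exact mul_le_mul_of_nonneg_left (hv s') (M.P_nonneg s a s')
    _ = r := by rw [← Finset.sum_mul, M.P_sum_eq_one, one_mul]

theorem measurable_maxAction {S A Ω : Type*} [Fintype A] [Nonempty A] {m : MeasurableSpace Ω}
    {Q : Ω → S → A → ℝ}
    (hQ : ∀ s a, Measurable fun ω => Q ω s a) (s : S) :
    Measurable fun ω => maxAction (Q ω) s := by
  have h := Finset.measurable_sup' (s := (Finset.univ : Finset A)) Finset.univ_nonempty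
    (f := fun a ω => Q ω s a) fun a _ => hQ s a
  convert h using 1
  funext ω
  simp [maxAction, Finset.sup'_apply]

/-- Evaluation at a random state becomes a finite sum, which serves both measurability and
conditional expectations without a σ-algebra on `S`. -/
theorem eq_sum_indicator_mul {S Ω : Type*} [Fintype S] (Y : Ω → S) (v : S → ℝ) (ω : Ω) :
    v (Y ω) = ∑ s', v s' * Set.indicator {ω | Y ω = s'} (fun _ => (1 : ℝ)) ω := by
  classical
  simp [Set.indicator_apply]

/-! ### Q-tables and the regularized Bellman operator -/

section QTable

variable {S A : Type*} [Fintype S] [Fintype A]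

theorem abs_apply_le_norm (Q : S → A → ℝ) (s : S) (a : A) : |Q s a| ≤ ‖Q‖ :=
  (norm_le_pi_norm (Q s) a).trans (norm_le_pi_norm Q s)

theorem norm_le_of_forall_abs_le {Q : S → A → ℝ} {r : ℝ} (hr : 0 ≤ r)
    (h : ∀ s a, |Q s a| ≤ r) : ‖Q‖ ≤ r :=
  (pi_norm_le_iff_of_nonneg hr).2 fun s => (pi_norm_le_iff_of_nonneg hr).2 fun a => h s a

variable [Nonempty A]

theorem abs_maxAction_sub_le (Q₁ Q₂ : S → A → ℝ) (s : S) :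
    |maxAction Q₁ s - maxAction Q₂ s| ≤ ‖Q₁ - Q₂‖ := by
  have key : ∀ Q₁ Q₂ : S → A → ℝ, maxAction Q₁ s ≤ maxAction Q₂ s + ‖Q₁ - Q₂‖ := by
    intro Q₁ Q₂
    refine Finset.sup'_le _ _ fun a ha => ?_
    have h1 : Q₂ s a ≤ maxAction Q₂ s := Finset.le_sup' (fun a => Q₂ s a) ha
    have h2 := (abs_le.1 (abs_apply_le_norm (Q₁ - Q₂) s a)).2
    simp only [Pi.sub_apply] at h2
    linarith
  have h1 := key Q₁ Q₂
  have h2 := key Q₂ Q₁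
  rw [norm_sub_rev] at h2
  exact abs_le.2 ⟨by linarith, by linarith⟩

theorem abs_maxAction_le (Q : S → A → ℝ) (s : S) : |maxAction Q s| ≤ ‖Q‖ := by
  have h := abs_maxAction_sub_le Q 0 s
  have h0 : maxAction (0 : S → A → ℝ) s = 0 := by simp [maxAction]
  simpa [h0] using h

variable (M : FiniteMDP S A) {γ lam : ℝ} (Qmeta : S → A → ℝ)

theorem norm_regBellman_sub_le (hγ₀ : 0 ≤ γ) (hlam : 0 ≤ lam) (Q₁ Q₂ : S → A → ℝ) :
    ‖regBellman M γ lam Qmeta Q₁ - regBellman M γ lam Qmeta Q₂‖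
      ≤ γ / (1 + lam) * ‖Q₁ - Q₂‖ := by
  have hc : 0 ≤ γ / (1 + lam) := by positivity
  refine norm_le_of_forall_abs_le (by positivity) fun s a => ?_
  have h1 : (regBellman M γ lam Qmeta Q₁ - regBellman M γ lam Qmeta Q₂) s a =
      γ / (1 + lam) * ∑ s', M.P s a s' * (maxAction Q₁ s' - maxAction Q₂ s') := by
    simp only [Pi.sub_apply, regBellman, bellman, mul_sub, Finset.sum_sub_distrib]
    ring
  rw [h1, abs_mul, abs_of_nonneg hc]
  exact mul_le_mul_of_nonneg_left (M.abs_sum_mul_le s a (abs_maxAction_sub_le Q₁ Q₂)) hc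

theorem discount_div_lt_one (hγ₁ : γ < 1) (hlam : 0 ≤ lam) : γ / (1 + lam) < 1 :=
  (div_lt_one (by linarith)).2 (by linarith)

theorem exists_forall_isFixedPt_regBellman_iff (hγ₀ : 0 ≤ γ) (hγ₁ : γ < 1) (hlam : 0 ≤ lam) :
    ∃ Qstar : S → A → ℝ, ∀ Q, Function.IsFixedPt (regBellman M γ lam Qmeta) Q ↔ Q = Qstar := by
  have hc : 0 ≤ γ / (1 + lam) := by positivity
  have hcontr : ContractingWith ⟨γ / (1 + lam), hc⟩ (regBellman M γ lam Qmeta) := by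
    refine ⟨discount_div_lt_one hγ₁ hlam, LipschitzWith.of_dist_le_mul fun Q₁ Q₂ => ?_⟩
    rw [dist_eq_norm, dist_eq_norm]
    exact norm_regBellman_sub_le M Qmeta hγ₀ hlam Q₁ Q₂
  refine ⟨hcontr.fixedPoint, fun Q => ⟨fun h => hcontr.fixedPoint_unique h, ?_⟩⟩
  rintro rfl
  exact hcontr.fixedPoint_isFixedPt

/-- The `+ 0` is the noise slot of `tendsto_of_contracting_of_noise`. -/
theorem exactQ_succ (hlam : 0 ≤ lam) (η : ℕ → ℝ) (Q₀ : S → A → ℝ) (k : ℕ) :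
    exactQ M γ lam η Qmeta Q₀ (k + 1) = exactQ M γ lam η Qmeta Q₀ k +
      ((1 + lam) * η k) • (regBellman M γ lam Qmeta (exactQ M γ lam η Qmeta Q₀ k) + 0
        - exactQ M γ lam η Qmeta Q₀ k) := by
  funext s a
  have : 1 + lam ≠ 0 := by positivity
  simp only [exactQ, penaltyGrad, regBellman, bellman, Pi.add_apply, Pi.sub_apply, Pi.smul_apply,
    smul_eq_mul, Pi.zero_apply]
  field_simp
  ring

/-- The sampling error of the regularized Bellman operator at `Q` for the next states `x`. -/
noncomputable def samplingNoise (M : FiniteMDP S A) (γ lam : ℝ) (Q : S → A → ℝ) (x : S → A → S) :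
    S → A → ℝ :=
  fun s a => γ / (1 + lam) * (maxAction Q (x s a) - ∑ s', M.P s a s' * maxAction Q s')

theorem abs_samplingNoise_le (hγ₀ : 0 ≤ γ) (hlam : 0 ≤ lam) (Q : S → A → ℝ) (x : S → A → S)
    (s : S) (a : A) : |samplingNoise M γ lam Q x s a| ≤ γ / (1 + lam) * (2 * ‖Q‖) := by
  have hc : 0 ≤ γ / (1 + lam) := by positivity
  rw [samplingNoise, abs_mul, abs_of_nonneg hc, two_mul]
  exact mul_le_mul_of_nonneg_left ((abs_sub _ _).trans (add_le_add (abs_maxAction_le Q _)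
    (M.abs_sum_mul_le s a (abs_maxAction_le Q)))) hc

theorem sampledQ_succ (hlam : 0 ≤ lam) (η : ℕ → ℝ) (Q₀ : S → A → ℝ) (x : ℕ → S → A → S) (k : ℕ) :
    sampledQ M γ lam η Qmeta Q₀ x (k + 1) = sampledQ M γ lam η Qmeta Q₀ x k +
      ((1 + lam) * η k) • (regBellman M γ lam Qmeta (sampledQ M γ lam η Qmeta Q₀ x k)
        + samplingNoise M γ lam (sampledQ M γ lam η Qmeta Q₀ x k) (x k)
        - sampledQ M γ lam η Qmeta Q₀ x k) := by
  funext s a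
  have : 1 + lam ≠ 0 := by positivity
  simp only [sampledQ, penaltyGrad, regBellman, bellman, samplingNoise, Pi.add_apply,
    Pi.sub_apply, Pi.smul_apply, smul_eq_mul]
  field_simp
  ring

/-- Uniformity in `x` is the point: it makes the martingale difference bounds deterministic. -/
theorem exists_norm_sampledQ_le (hγ₀ : 0 ≤ γ) (hγ₁ : γ < 1) (hlam : 0 ≤ lam) {η : ℕ → ℝ}
    (hη₀ : ∀ k, 0 ≤ η k) (hη₁ : ∀ᶠ k in atTop, (1 + lam) * η k ≤ 1) (Q₀ : S → A → ℝ) :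
    ∃ B, ∀ x k, ‖sampledQ M γ lam η Qmeta Q₀ x k‖ ≤ B := by
  have hc : 0 ≤ γ / (1 + lam) := by positivity
  have hα₀ : ∀ k, 0 ≤ (1 + lam) * η k := fun k => mul_nonneg (by linarith) (hη₀ k)
  obtain ⟨B, hB⟩ := exists_bound_of_average_affine hα₀ hη₁ hc (discount_div_lt_one hγ₁ hlam)
    (lam / (1 + lam) * ‖Qmeta‖ + 1 / (1 + lam) * ‖M.R‖) ‖Q₀‖
  refine ⟨B, fun x k => hB (fun k => ‖sampledQ M γ lam η Qmeta Q₀ x k‖) le_rfl (fun k => ?_) k⟩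
  have hα := hα₀ k
  set Q := sampledQ M γ lam η Qmeta Q₀ x k with hQ
  refine norm_le_of_forall_abs_le (by positivity) fun s a => ?_
  have h1 : sampledQ M γ lam η Qmeta Q₀ x (k + 1) s a = (1 - (1 + lam) * η k) * Q s a +
      (1 + lam) * η k * (lam / (1 + lam) * Qmeta s a + 1 / (1 + lam) * M.R s a +
        γ / (1 + lam) * maxAction Q (x k s a)) := by
    have : 1 + lam ≠ 0 := by positivity
    simp only [sampledQ, penaltyGrad, ← hQ]
    field_simp
    ring
  rw [h1]
  refine (abs_add_le _ _).trans ?_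
  rw [abs_mul, abs_mul ((1 + lam) * η k), abs_of_nonneg hα]
  have h2 : |lam / (1 + lam) * Qmeta s a + 1 / (1 + lam) * M.R s a +
      γ / (1 + lam) * maxAction Q (x k s a)| ≤ lam / (1 + lam) * ‖Qmeta‖ + 1 / (1 + lam) * ‖M.R‖
        + γ / (1 + lam) * ‖Q‖ := by
    refine (abs_add_three _ _ _).trans ?_
    rw [abs_mul, abs_mul, abs_mul, abs_of_nonneg hc,
      abs_of_nonneg (show 0 ≤ lam / (1 + lam) by positivity),
      abs_of_nonneg (show 0 ≤ 1 / (1 + lam) by positivity)]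
    gcongr
    · exact abs_apply_le_norm _ _ _
    · exact abs_apply_le_norm _ _ _
    · exact abs_maxAction_le _ _
  gcongr
  exact abs_apply_le_norm _ _ _

/-! ### Sampling noise and convergence of the iterations -/

variable {Ω : Type*} {mΩ : MeasurableSpace Ω} {μ : Measure Ω} {ℱ : Filtration ℕ mΩ}
  {X : ℕ → Ω → S → A → S}

theorem IsTransitionSampling.measurable_sampledQ {M : FiniteMDP S A}
    (hX : IsTransitionSampling μ ℱ M X) (γ lam : ℝ) (η : ℕ → ℝ) (Q₀ : S → A → ℝ) (k : ℕ) :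
    ∀ s a, Measurable[ℱ k] fun ω => sampledQ M γ lam η Qmeta Q₀ (fun j => X j ω) k s a := by
  induction k with
  | zero => intro s a; exact measurable_const
  | succ k ih =>
    intro s a
    have ih' : ∀ s a, Measurable[ℱ (k + 1)]
        fun ω => sampledQ M γ lam η Qmeta Q₀ (fun j => X j ω) k s a :=
      fun s a => (ih s a).mono (ℱ.mono k.le_succ) le_rfl
    have hmax : Measurable[ℱ (k + 1)] fun ω =>
        maxAction (sampledQ M γ lam η Qmeta Q₀ (fun j => X j ω) k) (X k ω s a) := by
      simp only [fun ω => eq_sum_indicator_mul (fun ω => X k ω s a)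
        (maxAction (sampledQ M γ lam η Qmeta Q₀ (fun j => X j ω) k)) ω]
      exact Finset.measurable_fun_sum _ fun s' _ => (measurable_maxAction ih' s').mul
        (measurable_const.indicator (hX.measurable k s a s'))
    simp only [sampledQ, penaltyGrad]
    exact ((ih' s a).add (((hmax.const_mul γ).const_add _ |>.sub (ih' s a)).const_mul _)).sub
      ((((ih' s a).sub_const _).const_mul 2).const_mul _)

/-- The noise is a finite sum of bounded `ℱ k`-measurable factors times centred indicators of the
next state, so the factors pull out and each term vanishes. -/
theorem IsTransitionSampling.condExp_samplingNoise [IsProbabilityMeasure μ] {M : FiniteMDP S A}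
    (hX : IsTransitionSampling μ ℱ M X) (t γ lam : ℝ) {k : ℕ} {Q : Ω → S → A → ℝ} {B : ℝ}
    (hQ : ∀ s a, Measurable[ℱ k] fun ω => Q ω s a) (hB : ∀ ω, ‖Q ω‖ ≤ B) (s : S) (a : A) :
    μ[fun ω => t * samplingNoise M γ lam (Q ω) (X k ω) s a | ℱ k] =ᵐ[μ] 0 := by
  set g : S → Ω → ℝ := fun s' ω => t * (γ / (1 + lam)) * maxAction (Q ω) s' with hg
  set I : S → Ω → ℝ := fun s' => Set.indicator {ω | X k ω s a = s'} (fun _ => (1 : ℝ)) with hI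
  set h : S → Ω → ℝ := fun s' => I s' - fun _ => M.P s a s' with hh
  have heq : (fun ω => t * samplingNoise M γ lam (Q ω) (X k ω) s a) = ∑ s', g s' * h s' := by
    funext ω
    simp only [samplingNoise, Finset.sum_apply, Pi.mul_apply, hg, hh, Pi.sub_apply, mul_sub,
      Finset.sum_sub_distrib]
    rw [eq_sum_indicator_mul (fun ω => X k ω s a) (maxAction (Q ω)) ω]
    simp only [Finset.mul_sum]
    congr 1 <;> exact Finset.sum_congr rfl fun s' _ => by ring
  have hgm : ∀ s', StronglyMeasurable[ℱ k] (g s') := fun s' =>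
    ((measurable_maxAction hQ s').const_mul _).stronglyMeasurable
  have hgb : ∀ s', ∀ᵐ ω ∂μ, ‖g s' ω‖ ≤ |t * (γ / (1 + lam))| * B := fun s' =>
    ae_of_all _ fun ω => by
      rw [hg, Real.norm_eq_abs, abs_mul]
      exact mul_le_mul_of_nonneg_left ((abs_maxAction_le _ _).trans (hB ω)) (abs_nonneg _)
  have hIi : ∀ s', Integrable (I s') μ := fun s' =>
    (integrable_const _).indicator (ℱ.le _ _ (hX.measurable k s a s'))
  have hhi : ∀ s', Integrable (h s') μ := fun s' => (hIi s').sub (integrable_const _)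
  have hh₀ : ∀ s', μ[h s' | ℱ k] =ᵐ[μ] 0 := fun s' => by
    filter_upwards [condExp_sub (hIi s') (integrable_const (M.P s a s')) (ℱ k),
      hX.law k s a s'] with ω h1 h2
    rw [h1, Pi.sub_apply, h2, condExp_const (ℱ.le k)]
    simp
  have hterm : ∀ s', μ[g s' * h s' | ℱ k] =ᵐ[μ] 0 := fun s' => by
    filter_upwards [condExp_stronglyMeasurable_mul_of_bound (ℱ.le k) (hgm s') (hhi s') _ (hgb s'),
      hh₀ s'] with ω h1 h2
    rw [h1, Pi.mul_apply, h2]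
    simp
  rw [heq]
  refine (condExp_finsetSum (fun s' _ => (hhi s').bdd_mul
    ((hgm s').mono (ℱ.le k)).aestronglyMeasurable (hgb s')) _).trans ?_
  filter_upwards [ae_all_iff.2 hterm] with ω hω
  rw [Finset.sum_apply]
  exact Finset.sum_eq_zero fun s' _ => hω s'

theorem eventually_mul_le_one_of_summable_sq {η : ℕ → ℝ} (hη₂ : Summable fun k => η k ^ 2)
    (c : ℝ) : ∀ᶠ k in atTop, c * η k ≤ 1 := by
  have h1 : Tendsto (fun k => (c * η k) ^ 2) atTop (𝓝 0) := by
    simpa [mul_pow] using hη₂.tendsto_atTop_zero.const_mul (c ^ 2)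
  filter_upwards [h1.eventually (gt_mem_nhds one_pos)] with k hk
  nlinarith

theorem tendsto_exactQ (hγ₀ : 0 ≤ γ) (hγ₁ : γ < 1) (hlam : 0 ≤ lam) {η : ℕ → ℝ}
    (hη₀ : ∀ k, 0 ≤ η k) (hη₁ : ¬ Summable η) (hη₂ : Summable fun k => η k ^ 2)
    (Q₀ : S → A → ℝ) {Qstar : S → A → ℝ}
    (hQ : Function.IsFixedPt (regBellman M γ lam Qmeta) Qstar) :
    Tendsto (exactQ M γ lam η Qmeta Q₀) atTop (𝓝 Qstar) := by
  refine tendsto_of_contracting_of_noise (F := regBellman M γ lam Qmeta) (w := 0) (L := 0)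
    (by positivity) (discount_div_lt_one hγ₁ hlam) (fun Q => ?_)
    (fun k => mul_nonneg (by linarith) (hη₀ k)) (eventually_mul_le_one_of_summable_sq hη₂ _)
    ?_ (exactQ_succ M Qmeta hlam η Q₀) (by simp)
  · conv_lhs => rw [← hQ.eq]
    exact norm_regBellman_sub_le M Qmeta hγ₀ hlam Q Qstar
  · rwa [summable_mul_left_iff (by positivity)]

theorem IsTransitionSampling.ae_tendsto_sampledQ [IsProbabilityMeasure μ] {M : FiniteMDP S A}
    (hX : IsTransitionSampling μ ℱ M X) (hγ₀ : 0 ≤ γ) (hγ₁ : γ < 1) (hlam : 0 ≤ lam) {η : ℕ → ℝ}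
    (hη₀ : ∀ k, 0 ≤ η k) (hη₁ : ¬ Summable η) (hη₂ : Summable fun k => η k ^ 2)
    (Q₀ : S → A → ℝ) {Qstar : S → A → ℝ}
    (hQ : Function.IsFixedPt (regBellman M γ lam Qmeta) Qstar) :
    ∀ᵐ ω ∂μ, Tendsto (sampledQ M γ lam η Qmeta Q₀ fun j => X j ω) atTop (𝓝 Qstar) := by
  have hα₁ := eventually_mul_le_one_of_summable_sq hη₂ (1 + lam)
  have hα₀ : ∀ k, 0 ≤ (1 + lam) * η k := fun k => mul_nonneg (by linarith) (hη₀ k)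
  obtain ⟨B, hB⟩ := exists_norm_sampledQ_le M Qmeta hγ₀ hγ₁ hlam hη₀ hα₁ Q₀
  have hnoise : ∀ s a, ∀ᵐ ω ∂μ, ∃ l, Tendsto (fun n => ∑ k ∈ Finset.range n,
      (1 + lam) * η k * samplingNoise M γ lam
        (sampledQ M γ lam η Qmeta Q₀ (fun j => X j ω) k) (X k ω) s a) atTop (𝓝 l) := by
    intro s a
    refine ae_exists_tendsto_sum_of_martingale_difference (ℱ := ℱ)
      (d := fun k ω => (1 + lam) * η k * samplingNoise M γ lam
        (sampledQ M γ lam η Qmeta Q₀ (fun j => X j ω) k) (X k ω) s a)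
      (b := fun k => (1 + lam) * η k * (γ / (1 + lam) * (2 * B))) (fun k => ?_) (fun k ω => ?_) ?_
      fun k => hX.condExp_samplingNoise _ γ lam (hX.measurable_sampledQ Qmeta γ lam η Q₀ k)
        (fun ω => hB _ k) s a
    · have hm : ∀ s a, Measurable[ℱ (k + 1)]
          fun ω => sampledQ M γ lam η Qmeta Q₀ (fun j => X j ω) k s a := fun s a =>
        (hX.measurable_sampledQ Qmeta γ lam η Q₀ k s a).mono (ℱ.mono k.le_succ) le_rfl
      simp only [samplingNoise, fun ω => eq_sum_indicator_mul (fun ω => X k ω s a)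
        (maxAction (sampledQ M γ lam η Qmeta Q₀ (fun j => X j ω) k)) ω]
      refine Measurable.stronglyMeasurable (((Measurable.sub ?_ ?_).const_mul _).const_mul _)
      · exact Finset.measurable_fun_sum _ fun s' _ => (measurable_maxAction hm s').mul
          (measurable_const.indicator (hX.measurable k s a s'))
      · exact Finset.measurable_fun_sum _ fun s' _ => (measurable_maxAction hm s').const_mul _
    · rw [abs_mul, abs_of_nonneg (hα₀ k)]
      refine mul_le_mul_of_nonneg_left ((abs_samplingNoise_le M hγ₀ hlam _ _ s a).trans ?_) (hα₀ k)
      gcongr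
      exact hB _ k
    · simp only [mul_pow]
      exact (hη₂.mul_left _).mul_right _
  filter_upwards [ae_all_iff.2 fun s => ae_all_iff.2 (hnoise s)] with ω hω
  choose L hL using hω
  refine tendsto_of_contracting_of_noise (F := regBellman M γ lam Qmeta) (L := L)
    (by positivity) (discount_div_lt_one hγ₁ hlam) (fun Q => ?_) hα₀ hα₁ ?_
    (sampledQ_succ M Qmeta hlam η Q₀ fun j => X j ω) ?_
  · conv_lhs => rw [← hQ.eq]
    exact norm_regBellman_sub_le M Qmeta hγ₀ hlam Q Qstar
  · rwa [summable_mul_left_iff (by positivity)]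
  · refine tendsto_pi_nhds.2 fun s => tendsto_pi_nhds.2 fun a => ?_
    simpa only [Finset.sum_apply, Pi.smul_apply, smul_eq_mul] using hL s a

end QTable

theorem theorem1 {N : ℕ} {S : Fin N → Type*} {A : Fin N → Type*}
    [∀ i, Fintype (S i)] [∀ i, Fintype (A i)] [∀ i, Nonempty (A i)]
    (M : ∀ i, FiniteMDP (S i) (A i))
    (γ lam : ℝ) (hγ₀ : 0 ≤ γ) (hγ₁ : γ < 1) (hlam : 0 ≤ lam)
    (η : ℕ → ℝ) (hη₀ : ∀ k, 0 ≤ η k) (hη₁ : ¬ Summable η) (hη₂ : Summable fun k => η k ^ 2)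
    (Qmeta : ∀ i, S i → A i → ℝ) (Q₀ Qs₀ : ∀ i, S i → A i → ℝ)
    {Ω : Type*} {mΩ : MeasurableSpace Ω} (μ : Measure Ω) [IsProbabilityMeasure μ]
    (ℱ : Filtration ℕ mΩ)
    (X : ∀ i, ℕ → Ω → S i → A i → S i)
    (hX : ∀ i, IsTransitionSampling μ ℱ (M i) (X i)) :
    (∀ i, ∀ Q₁ Q₂ : S i → A i → ℝ,
      ‖regBellman (M i) γ lam (Qmeta i) Q₁ - regBellman (M i) γ lam (Qmeta i) Q₂‖
        ≤ γ / (1 + lam) * ‖Q₁ - Q₂‖) ∧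
    (∃ Qstar : ∀ i, S i → A i → ℝ,
      (∀ i, ∀ Q, Function.IsFixedPt (regBellman (M i) γ lam (Qmeta i)) Q ↔ Q = Qstar i) ∧
      ∀ᵐ ω ∂μ, ∀ i,
        Tendsto (fun k => sampledQ (M i) γ lam η (Qmeta i) (Qs₀ i) (fun j => X i j ω) k)
          atTop (𝓝 (Qstar i))) ∧
    (∀ᵐ ω ∂μ, ∀ δ : ℝ, 0 < δ → ∃ K₀ : ℕ, ∀ K, K₀ ≤ K → ∀ i s a,
      |exactQ (M i) γ lam η (Qmeta i) (Q₀ i) K s a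
        - sampledQ (M i) γ lam η (Qmeta i) (Qs₀ i) (fun j => X i j ω) K s a| ≤ δ) := by
  choose Qstar hQstar using fun i =>
    exists_forall_isFixedPt_regBellman_iff (M i) (Qmeta i) hγ₀ hγ₁ hlam
  have hfix : ∀ i, Function.IsFixedPt (regBellman (M i) γ lam (Qmeta i)) (Qstar i) :=
    fun i => (hQstar i _).2 rfl
  have hsampled : ∀ᵐ ω ∂μ, ∀ i,
      Tendsto (fun k => sampledQ (M i) γ lam η (Qmeta i) (Qs₀ i) (fun j => X i j ω) k)
        atTop (𝓝 (Qstar i)) :=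
    ae_all_iff.2 fun i =>
      (hX i).ae_tendsto_sampledQ (Qmeta i) hγ₀ hγ₁ hlam hη₀ hη₁ hη₂ (Qs₀ i) (hfix i)
  refine ⟨fun i => norm_regBellman_sub_le (M i) (Qmeta i) hγ₀ hlam,
    ⟨Qstar, hQstar, hsampled⟩, ?_⟩
  filter_upwards [hsampled] with ω hω δ hδ
  have hev : ∀ i, ∀ᶠ K in atTop, ‖exactQ (M i) γ lam η (Qmeta i) (Q₀ i) K
      - sampledQ (M i) γ lam η (Qmeta i) (Qs₀ i) (fun j => X i j ω) K‖ < δ := fun i => by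
    have h := ((tendsto_exactQ (M i) (Qmeta i) hγ₀ hγ₁ hlam hη₀ hη₁ hη₂ (Q₀ i) (hfix i)).sub
      (hω i)).norm
    rw [sub_self, norm_zero] at h
    exact h.eventually (gt_mem_nhds hδ)
  -- Finitely many tasks allow a common `K₀`; the sup norm covers all states and actions.
  obtain ⟨K₀, hK₀⟩ := eventually_atTop.1 (eventually_all.2 hev)
  exact ⟨K₀, fun K hK i s a => (abs_apply_le_norm (exactQ (M i) γ lam η (Qmeta i) (Q₀ i) K
    - sampledQ (M i) γ lam η (Qmeta i) (Qs₀ i) (fun j => X i j ω) K) s a).trans (hK₀ K hK i).le⟩
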